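/- **Setting.** Let $\mathcal X\subseteq\mathbb R^{n_x}$ and $\mathcal Z\subseteq\mathbb R^{n_z}$ be convex sets containing the origin, let $\|\cdot\|_{\mathcal X}$, $\|\cdot\|_{\mathcal Z}$ be norms on $\mathbb R^{n_x}$, $\mathbb R^{n_z}$, and let $[\![\cdot;\cdot]\!]$ be a weak pairing on $\mathbb R^{n_x}$ compatible with $\|\cdot\|_{\mathcal X}$ (it is sub-additive and continuous in the first argument, $[\![ax;y]\!]=[\![x;ay]\!]=a[\![x;y]\!]$ for $a\ge0$, $[\![-x;-y]\!]=[\![x;y]\!]$, it is positive definite, satisfies the Cauchy–Schwarz inequality, and $[\![x;x]\!]=\|x\|_{\mathcal X}^2$). Let $f$ and $\mathsf G$ take values in $\mathbb R^{n_x}$ and $\mathbb R^{n_z}$, be continuous on $\mathcal X\times\mathcal Z$, with $\mathsf G(\mathcal X\times\mathcal Z)\subseteq\mathcal Z$, $f(0,0)=0$ and $\mathsf G(0,0)=0$. For an integer $n\ge1$ and $T>0$ let $\mathsf G^n(x,\cdot)$ be the $n$-fold composition of $\mathsf G(x,\cdot)$, and consider the system $$\dot x(t)=f(x(t),z(t)),\qquad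 z(t)=z_k\ \text{ for } t\in[kT,(k+1)T),\qquad z_{k}=\mathsf G^n(x(kT),z_{k-1})\quad(k\ge1),$$ with $z_0=z(0)$. Its solutions are defined for $t\ge0$, with $x$ continuous. Let $\mathsf{Lip}_x(f),\mathsf{Lip}_z(f),\mathsf{Lip}_x(\mathsf G),\mathsf{Lip}_z(\mathsf G)$ be the minimal Lipschitz constants, on $\mathcal X\times\mathcal Z$, of $f$ and $\mathsf G$ in one argument, uniformly in the other one. Assume that all four are finite, that $\mathsf{Lip}_z(f)>0$, $\mathsf{Lip}_x(\mathsf G)>0$, and $\ell:=\mathsf{Lip}_z(\mathsf G)<1$. For $x\in\mathcal X$ let $z^*(x)\in\mathcal Z$ be the fixed point $z^*(x)=\mathsf G(x,z^*(x))$ (it is unique, and it exists for instance if $\mathcal Z$ is closed). Let $\xi\in\mathbb R$ and $\zeta>0$ satisfy $$\sup_{z\in\mathcal Z}\ \sup_{x\ne\bar x\in\mathcal X}\frac{[\![f(x,z)-f(\bar x,z);x-\bar x]\!]}{\|x-\bar x\|_{\mathcal X}^2}\le\xi,\qquad \sup_{x\neq\bar x\in\mathcal X}\frac{[\![f(x,z^*(x))-f(\bar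 x,z^*(\bar x));x-\bar x]\!]}{\|x-\bar x\|_{\mathcal X}^2}\le-\zeta .$$ **Constants.** Put $h:=\int_0^T e^{\xi(T-s)}ds$, $q:=\frac{\mathsf{Lip}_x(\mathsf G)}{1-\ell}$, $C_1:=\mathsf{Lip}_z(f)\,q\,(\mathsf{Lip}_x(f)+\mathsf{Lip}_z(f)\,q)$, $C_2(n):=\ell^n q\,\mathsf{Lip}_z(f)$, $C_{12}:=\mathsf{Lip}_z(f)^2q$, $C_{21}(n):=\ell^n q\,(\mathsf{Lip}_x(f)+\mathsf{Lip}_z(f)\,q)$, $$T(n):=\begin{cases}\dfrac1\xi\log\Big(\dfrac{\xi(1-\ell^n)}{C_2(n)+C_1/\zeta}+1\Big)&\xi\ne0,\\[2ex]\dfrac{1-\ell^n}{C_2(n)+C_1/\zeta}&\xi=0,\end{cases}$$ with $T(n):=+\infty$ when the argument of the logarithm is not positive (which can happen only for $\xi<0$), and $$\overline{\mathcal A}:=\begin{bmatrix}e^{-\zeta T}+\frac{1-e^{-\zeta T}}{\zeta}hC_1&\frac{1-e^{-\zeta T}}{\zeta}(\mathsf{Lip}_z(f)+hC_{12})\\ hC_{21}(n)&hC_2(n)+\ell^n\end{bmatrix},\quad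 \mathcal B:=\begin{bmatrix}\max\{e^{\xi T},1\}&\mathsf{Lip}_z(f)h\\0&1\end{bmatrix},\quad L:=\begin{bmatrix}1&0\\ q&1\end{bmatrix}.$$ For $\eta\in\mathbb R^2_{>0}$ let $\|v\|_{2,[\eta]}:=(\eta_1v_1^2+\eta_2v_2^2)^{1/2}$ on $\mathbb R^2$, with the same symbol for the induced matrix norm, and let $\rho$ denote the spectral radius. **Corollary (local exponential stability).** Let $n\ge1$ and $0<T<T(n)$. Then $\alpha:=-\frac1T\ln\rho(\overline{\mathcal A})>0$, and there is $\eta\in\mathbb R^2_{>0}$, with $\|\overline{\mathcal A}\|_{2,[\eta]}=\rho(\overline{\mathcal A})$ if $\ell>0$, such that the following holds for $\varrho:=\frac1{\rho(\overline{\mathcal A})}\|\mathcal B\|_{2,[\eta]}^2\|L\|_{2,[\eta]}^2$. Let $\mathcal X_0\subseteq\mathcal X$, $\mathcal Z_0\subseteq\mathcal Z$ be such that every solution with $(x(0),z(0))\in\mathcal X_0\times\mathcal Z_0$ satisfies $(x(t),z(t))\in\mathcal X\times\mathcal Z$ for all $t\ge0$. Then every solution with $x(0)\in\mathcal X_0$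 and $z(0)\in\mathcal Z_0$ satisfies $$\left\|\begin{bmatrix}\|x(t)\|_{\mathcal X}\\\|z(t)\|_{\mathcal Z}\end{bmatrix}\right\|_{2,[\eta]}\le\varrho\,e^{-\alpha t}\left\|\begin{bmatrix}\|x(0)\|_{\mathcal X}\\\|z(0)\|_{\mathcal Z}\end{bmatrix}\right\|_{2,[\eta]}\qquad\text{for all }t\ge0 .$$ -/

import Mathlib

open Set

noncomputable section

/-- A weak pairing on a real normed space: sub-additive and continuous in the first argument,
weakly homogeneous, positive definite, and satisfying the Cauchy-Schwarz inequality. -/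
structure IsWeakPairing {E : Type*} [NormedAddCommGroup E] [NormedSpace ℝ E]
    (wp : E → E → ℝ) : Prop where
  add_le : ∀ x₁ x₂ y, wp (x₁ + x₂) y ≤ wp x₁ y + wp x₂ y
  continuous_left : ∀ y, Continuous fun x => wp x y
  smul_left : ∀ (a : ℝ), 0 ≤ a → ∀ x y, wp (a • x) y = a * wp x y
  smul_right : ∀ (a : ℝ), 0 ≤ a → ∀ x y, wp x (a • y) = a * wp x y
  neg_neg : ∀ x y, wp (-x) (-y) = wp x y
  pos : ∀ x, x ≠ 0 → 0 < wp x x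
  cauchy_schwarz : ∀ x y, |wp x y| ≤ Real.sqrt (wp x x) * Real.sqrt (wp y y)

/-- The difference quotients of the maps `v ↦ F p v` on `C`, for all `p ∈ A`. -/
def lipQuotients {P V W : Type*} [NormedAddCommGroup V] [NormedAddCommGroup W]
    (F : P → V → W) (A : Set P) (C : Set V) : Set ℝ :=
  {r | ∃ p ∈ A, ∃ v₁ ∈ C, ∃ v₂ ∈ C, v₁ ≠ v₂ ∧ r = ‖F p v₁ - F p v₂‖ / ‖v₁ - v₂‖}

/-- The maps `v ↦ F p v` are Lipschitz on `C`, uniformly over `p ∈ A`. -/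
def UniformlyLipschitz {P V W : Type*} [NormedAddCommGroup V] [NormedAddCommGroup W]
    (F : P → V → W) (A : Set P) (C : Set V) : Prop :=
  BddAbove (lipQuotients F A C)

/-- The minimal uniform Lipschitz constant of the maps `v ↦ F p v` on `C`, over `p ∈ A`
(meaningful for uniformly Lipschitz families). -/
def lipConst {P V W : Type*} [NormedAddCommGroup V] [NormedAddCommGroup W]
    (F : P → V → W) (A : Set P) (C : Set V) : ℝ :=
  sSup (lipQuotients F A C)

/-- The minimal one-sided Lipschitz constant on `C` of `F`, with respect to the weak pairing `wp`. -/
def osLip {E : Type*} [NormedAddCommGroup E] (wp : E → E → ℝ) (F : E → E) (C : Set E) : EReal :=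
  ⨆ (x₁ ∈ C) (x₂ ∈ C) (_ : x₁ ≠ x₂),
    ((wp (F x₁ - F x₂) (x₁ - x₂) / ‖x₁ - x₂‖ ^ 2 : ℝ) : EReal)

/-- The minimal one-sided Lipschitz constant of `x ↦ F p x` on `C`, uniform over `p ∈ A`. -/
def osLipUnif {P E : Type*} [NormedAddCommGroup E] (wp : E → E → ℝ)
    (F : P → E → E) (A : Set P) (C : Set E) : EReal :=
  ⨆ p ∈ A, osLip wp (F p) C

/-- `(x, z)` is a solution, on `[0, ∞)`, of the sampled-data interconnection
`x'(t) = f (x t) (z t)`, `z t = z_k` for `t ∈ [kT, (k+1)T)`, where `z_0 = z 0` is the initial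
condition and `z_{k+1}` is obtained from `z_k` by `n` iterations of `G (x ((k+1)T))`. -/
structure IsSolution {E F : Type*} [NormedAddCommGroup E] [NormedSpace ℝ E]
    (f : E → F → E) (G : E → F → F) (n : ℕ) (T : ℝ) (x : ℝ → E) (z : ℝ → F) : Prop where
  continuousOn : ContinuousOn x (Ici 0)
  hasDeriv : ∀ k : ℕ, ∀ t ∈ Ico ((k : ℝ) * T) (((k : ℝ) + 1) * T),
    HasDerivWithinAt x (f (x t) (z t)) (Ico ((k : ℝ) * T) (((k : ℝ) + 1) * T)) t
  hold : ∀ k : ℕ, ∀ t ∈ Ico ((k : ℝ) * T) (((k : ℝ) + 1) * T), z t = z ((k : ℝ) * T)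
  update : ∀ k : ℕ, z (((k : ℝ) + 1) * T) = (G (x (((k : ℝ) + 1) * T)))^[n] (z ((k : ℝ) * T))

/-- The four Lipschitz gains `Lip_x(f)`, `Lip_z(f)`, `Lip_x(G)`, `Lip_z(G)`. -/
structure Gains where
  fx : ℝ
  fz : ℝ
  Gx : ℝ
  Gz : ℝ

/-- The minimal Lipschitz constants of `f` and `G` on `X × Z`. -/
def gains {E F : Type*} [NormedAddCommGroup E] [NormedAddCommGroup F]
    (f : E → F → E) (G : E → F → F) (X : Set E) (Z : Set F) : Gains where
  fx := lipConst (fun z x => f x z) Z X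
  fz := lipConst f X Z
  Gx := lipConst (fun z x => G x z) Z X
  Gz := lipConst G X Z

namespace Gains

def C1 (g : Gains) : ℝ :=
  g.fz * g.Gx / (1 - g.Gz) * (g.fx + g.fz * g.Gx / (1 - g.Gz))

def C2 (g : Gains) (n : ℕ) : ℝ :=
  g.Gz ^ n * (g.Gx * g.fz / (1 - g.Gz))

def C12 (g : Gains) : ℝ :=
  g.fz * g.Gx / (1 - g.Gz) * g.fz

def C21 (g : Gains) (n : ℕ) : ℝ :=
  g.Gz ^ n * g.Gx / (1 - g.Gz) * (g.fx + g.Gx * g.fz / (1 - g.Gz))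

/-- The integral of `exp (c * (t - s))` over `s ∈ [0, t]`, in closed form. -/
def h (t c : ℝ) : ℝ :=
  if c = 0 then t else (Real.exp (c * t) - 1) / c

/-- The upper bound `T(n)` on the sampling time. When the argument of the logarithm is not
positive (possible only for `ξ < 0`), there is no restriction and the bound is `+∞`. -/
def Tmax (g : Gains) (ζ ξ : ℝ) (n : ℕ) : EReal :=
  if ξ = 0 then (((1 - g.Gz ^ n) / (g.C2 n + g.C1 / ζ) : ℝ) : EReal)
  else if 0 < ξ * (1 - g.Gz ^ n) / (g.C2 n + g.C1 / ζ) + 1 then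
    ((1 / ξ * Real.log (ξ * (1 - g.Gz ^ n) / (g.C2 n + g.C1 / ζ) + 1) : ℝ) : EReal)
  else ⊤

/-- The gain matrix of one sampling period. -/
def Abar (g : Gains) (ζ ξ : ℝ) (n : ℕ) (T : ℝ) : Matrix (Fin 2) (Fin 2) ℝ :=
  !![Real.exp (-ζ * T) + (1 - Real.exp (-ζ * T)) / ζ * h T ξ * g.C1,
      (1 - Real.exp (-ζ * T)) / ζ * (g.fz + h T ξ * g.C12);
     h T ξ * g.C21 n,
      h T ξ * g.C2 n + g.Gz ^ n]

/-- The gain matrix inside a sampling period. -/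
def B (g : Gains) (ξ T : ℝ) : Matrix (Fin 2) (Fin 2) ℝ :=
  !![max (Real.exp (ξ * T)) 1, g.fz * h T ξ; 0, 1]

/-- The matrix relating `(‖x‖, ‖z‖)` and `(‖x‖, ‖z - z*(x)‖)`. -/
def L (g : Gains) : Matrix (Fin 2) (Fin 2) ℝ :=
  !![1, 0; g.Gx / (1 - g.Gz), 1]

end Gains

/-- The weighted `ℓ₂` norm on `ℝ²` with weights `η`. -/
def wNorm (η : Fin 2 → ℝ) (v : Fin 2 → ℝ) : ℝ :=
  Real.sqrt (∑ i, η i * |v i| ^ 2)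

/-- The matrix norm induced by the weighted `ℓ₂` norm. -/
def wOpNorm (η : Fin 2 → ℝ) (M : Matrix (Fin 2) (Fin 2) ℝ) : ℝ :=
  sSup {r | ∃ v : Fin 2 → ℝ, wNorm η v = 1 ∧ r = wNorm η (M.mulVec v)}

/-- The spectral radius of a real matrix (over its complex eigenvalues). -/
def specRad (M : Matrix (Fin 2) (Fin 2) ℝ) : ℝ :=
  (spectralRadius ℂ (M.map (algebraMap ℝ ℂ))).toReal

namespace Gains

/-- The exponential rate `α` of the transient bound. -/
def rate (g : Gains) (ζ ξ : ℝ) (n : ℕ) (T : ℝ) : ℝ :=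
  -(1 / T) * Real.log (specRad (g.Abar ζ ξ n T))

/-- The overshoot constant `ϱ` of the transient bound, in the norm with weights `η`. -/
def overshoot (g : Gains) (ζ ξ : ℝ) (n : ℕ) (T : ℝ) (η : Fin 2 → ℝ) : ℝ :=
  1 / specRad (g.Abar ζ ξ n T) * wOpNorm η (g.B ξ T) ^ 2 * wOpNorm η g.L ^ 2

end Gains

end

/-! The quantity to track is the pair `(‖x‖, ‖z - zstar x‖)` at the sampling instants. During a
period the input is frozen, so `x` drifts from its sample by at most `h` times the initial speed.
Since `zstar` is `q`-Lipschitz, this limits how far the held input strays from the moving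
equilibrium. That error, seen as a disturbance of the reduced dynamics (contracting at rate `ζ`),
gives the first row of `Abar`; the `n` iterations of `G` shrink it by `ℓ^n`, which gives the second
row. As `Abar` is nonnegative, its powers dominate the pair entrywise (`error_le_pow`).

The differential estimates all come from a Grönwall inequality for weak pairings
(`norm_le_of_deriv`). Sub-additivity controls only the left upper Dini derivative of the norm, which
is enough.

The condition `T < T(n)` makes `det (1 - Abar)` positive, which forces the Perron root below 1
(`exists_specRad_Abar`). If `ℓ > 0`, suitable weights symmetrise `Abar`, so its norm is its spectral
radius. If `ℓ = 0`, the second row vanishes and no weights achieve this; weights are then chosen so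
that `‖L‖` absorbs the defect (`exists_weights`). Finally, `L` passes between `z` and `z - zstar x`
at both ends, `B` covers the time since the last sample, and the factor `1 / ρ` pays for the
incomplete period. -/

/-! ### Comparison principles for left Dini derivatives. -/

open Filter Topology in
/-- A continuous function whose left upper Dini derivatives are nonpositive does not increase. -/
theorem le_of_left_slope_nonpos {u : ℝ → ℝ} {a b : ℝ} (hab : a ≤ b)
    (hu : ContinuousOn u (Icc a b))
    (hslope : ∀ t ∈ Ioo a b, ∃ (m : ℝ → ℝ) (M : ℝ), M ≤ 0 ∧ Tendsto m (𝓝[<] t) (𝓝 M) ∧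
      ∀ᶠ s in 𝓝[<] t, u t - u s ≤ (t - s) * m s) :
    u b ≤ u a := by
  -- The slope condition is not assumed at `b`, so the claim is proved for `b' < b` and extended by
  -- continuity. Reflecting the time axis turns left slopes into right slopes.
  have key : ∀ b' ∈ Ioo a b, u b' ≤ u a := by
    intro b' hb'
    have hy : ContinuousOn (fun s => -u (-s)) (Icc (-b') (-a)) := by
      refine (hu.comp continuous_neg.continuousOn ?_).neg
      intro s hs
      exact ⟨by linarith [hs.2], by linarith [hs.1, hb'.2]⟩
    have h := image_le_of_liminf_slope_right_le_deriv_boundary (f := fun s => -u (-s))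
      (B := fun _ => -u b') (B' := fun _ => 0) hy (by simp) continuousOn_const
      (fun x _ => hasDerivWithinAt_const _ _ _) ?_ (x := -a) ⟨by linarith [hb'.1], le_rfl⟩
    · simpa using h
    · intro s hs r hr
      obtain ⟨m, M, hM, hm, hms⟩ := hslope (-s) ⟨by linarith [hs.2], by linarith [hs.1, hb'.2]⟩
      have hneg : Tendsto (fun s' : ℝ => -s') (𝓝[>] s) (𝓝[<] (-s)) := by
        refine tendsto_nhdsWithin_iff.2 ⟨(continuous_neg.tendsto s).mono_left inf_le_left, ?_⟩
        filter_upwards [self_mem_nhdsWithin] with s' hs'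
        exact neg_lt_neg (mem_Ioi.1 hs')
      have h1 := hneg.eventually (hm.eventually (gt_mem_nhds (lt_of_le_of_lt hM hr)))
      refine (Eventually.and h1 ((hneg.eventually hms).and self_mem_nhdsWithin)).frequently.mono ?_
      rintro s' ⟨h2, h3, h4⟩
      have h5 : 0 < s' - s := sub_pos.2 h4
      rw [slope_def_field, div_lt_iff₀ h5]
      nlinarith
  rcases hab.eq_or_lt with rfl | hab'
  · exact le_rfl
  · have hne : (𝓝[Ioo a b] b).NeBot := right_nhdsWithin_Ioo_neBot hab'
    refine le_of_tendsto ((hu b (right_mem_Icc.2 hab)).mono_left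
      (nhdsWithin_mono b Ioo_subset_Icc_self)) ?_
    filter_upwards [self_mem_nhdsWithin] with t ht using key t ht

namespace Gains

theorem h_zero (c : ℝ) : h 0 c = 0 := by simp [h]

theorem hasDerivAt_h (c t : ℝ) : HasDerivAt (fun s => h s c) (Real.exp (c * t)) t := by
  unfold h
  by_cases hc : c = 0
  · simpa [hc] using hasDerivAt_id' t
  · simp only [hc, if_false]
    have h1 := (((hasDerivAt_id' t).const_mul c).exp.sub_const 1).div_const c
    exact h1.congr_deriv (by field_simp)

theorem mul_h_add_one (c t : ℝ) : c * h t c + 1 = Real.exp (c * t) := by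
  unfold h
  by_cases hc : c = 0
  · simp [hc]
  · simp only [hc, if_false]; field_simp; ring

theorem h_mono (c : ℝ) : StrictMono fun t => h t c :=
  strictMono_of_hasDerivAt_pos (fun t => hasDerivAt_h c t) fun _ => Real.exp_pos _

theorem h_pos {t : ℝ} (c : ℝ) (ht : 0 < t) : 0 < h t c := by
  simpa [h_zero] using h_mono c ht

theorem h_nonneg {t : ℝ} (c : ℝ) (ht : 0 ≤ t) : 0 ≤ h t c := by
  simpa [h_zero] using (h_mono c).monotone ht

end Gains

open Filter Topology in
/-- Comparison principle for functions with a bound on the left upper Dini derivative. -/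
theorem le_exp_of_left_slope_le {φ : ℝ → ℝ} {a b c d : ℝ} (hab : a ≤ b)
    (hφ : ContinuousOn φ (Icc a b))
    (hslope : ∀ t ∈ Ioo a b, ∃ (m : ℝ → ℝ) (M : ℝ), M ≤ c * φ t + d ∧
      Tendsto m (𝓝[<] t) (𝓝 M) ∧ ∀ᶠ s in 𝓝[<] t, φ t - φ s ≤ (t - s) * m s) :
    φ b ≤ Real.exp (c * (b - a)) * φ a + d * Gains.h (b - a) c := by
  -- Integrating factor `e`, and the primitive `g` of `d * e`; then `e * φ - g` has nonpositive left
  -- slopes.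
  set e : ℝ → ℝ := fun t => Real.exp (-(c * (t - a))) with he_def
  set g : ℝ → ℝ := fun t => d * (e t * Gains.h (t - a) c) with hg_def
  have he : ∀ t, HasDerivAt e (-(c * e t)) t := by
    intro t
    have h1 := ((((hasDerivAt_id' t).sub_const a).const_mul c).fun_neg).exp
    exact h1.congr_deriv (by rw [he_def]; ring)
  have hg : ∀ t, HasDerivAt g (d * e t) t := by
    intro t
    have h0 : HasDerivAt (fun s => Gains.h (s - a) c) (Real.exp (c * (t - a))) t :=
      (Gains.hasDerivAt_h c (t - a)).comp_sub_const t a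
    have h2 := Gains.mul_h_add_one c (t - a)
    exact (((he t).fun_mul h0).const_mul d).congr_deriv (by linear_combination -(d * e t) * h2)
  have he0 : ∀ t, 0 < e t := fun t => Real.exp_pos _
  have hcont : ContinuousOn (fun t => e t * φ t - g t) (Icc a b) :=
    (ContinuousOn.mul (fun t _ => (he t).continuousAt.continuousWithinAt) hφ).sub
      fun t _ => (hg t).continuousAt.continuousWithinAt
  have hmain := le_of_left_slope_nonpos hab hcont ?_
  · have h1 : e a = 1 := by simp [he_def]
    have h2 : e b * Real.exp (c * (b - a)) = 1 := by rw [he_def, ← Real.exp_add]; simp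
    simp only [hg_def, h1, sub_self, Gains.h_zero, one_mul, mul_zero, sub_zero] at hmain
    refine le_of_mul_le_mul_left ?_ (he0 b)
    linear_combination hmain - φ a * h2
  · intro t ht
    obtain ⟨m, M, hM, hm, hms⟩ := hslope t ht
    have hlt : 𝓝[<] t ≤ 𝓝[≠] t := nhdsWithin_mono t fun s hs => ne_of_lt hs
    have h1 : Tendsto (slope e t) (𝓝[<] t) (𝓝 (-(c * e t))) :=
      (hasDerivAt_iff_tendsto_slope.1 (he t)).mono_left hlt
    have h2 : Tendsto (slope g t) (𝓝[<] t) (𝓝 (d * e t)) :=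
      (hasDerivAt_iff_tendsto_slope.1 (hg t)).mono_left hlt
    have h3 : Tendsto φ (𝓝[<] t) (𝓝 (φ t)) :=
      ((hφ t (Ioo_subset_Icc_self ht)).continuousAt
        (Icc_mem_nhds ht.1 ht.2)).tendsto.mono_left inf_le_left
    refine ⟨fun s => e t * m s + slope e t s * φ s - slope g t s,
      e t * M + -(c * e t) * φ t - d * e t, ?_, ((hm.const_mul _).add (h1.mul h3)).sub h2, ?_⟩
    · nlinarith [mul_le_mul_of_nonneg_left hM (he0 t).le]
    · filter_upwards [hms, self_mem_nhdsWithin] with s hs hst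
      have hst' : t - s ≠ 0 := (sub_pos.2 hst).ne'
      have hst2 : s - t ≠ 0 := (sub_neg.2 hst).ne
      have h4 : (t - s) * slope e t s = e t - e s := by
        rw [slope_def_field]; field_simp; ring
      have h5 : (t - s) * slope g t s = g t - g s := by
        rw [slope_def_field]; field_simp; ring
      have h6 := mul_le_mul_of_nonneg_left hs (he0 t).le
      linear_combination h6 - φ s * h4 + h5

/-! ### Grönwall inequality for weak pairings. -/

namespace IsWeakPairing

variable {E : Type*} [NormedAddCommGroup E] [NormedSpace ℝ E] {wp : E → E → ℝ}

theorem le_norm_mul_norm (hwp : IsWeakPairing wp) (hn : ∀ x, wp x x = ‖x‖ ^ 2) (x y : E) :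
    wp x y ≤ ‖x‖ * ‖y‖ := by
  have := (le_abs_self _).trans (hwp.cauchy_schwarz x y)
  simpa [hn] using this

theorem le_add_norm (hwp : IsWeakPairing wp) (hn : ∀ x, wp x x = ‖x‖ ^ 2) (v w y : E) :
    wp v y ≤ wp w y + ‖v - w‖ * ‖y‖ := by
  have h1 := hwp.add_le w (v - w) y
  rw [add_sub_cancel] at h1
  linarith [hwp.le_norm_mul_norm hn (v - w) y]

open Filter Topology in
/-- Grönwall-type estimate for a curve whose velocity satisfies a one-sided bound. -/
theorem norm_le_of_deriv (hwp : IsWeakPairing wp) (hn : ∀ x, wp x x = ‖x‖ ^ 2)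
    {y y' : ℝ → E} {a b c d : ℝ} (hab : a ≤ b) (hd : 0 ≤ d) (hy : ContinuousOn y (Icc a b))
    (hy' : ∀ t ∈ Ioo a b, HasDerivAt y (y' t) t)
    (hle : ∀ t ∈ Ioo a b, wp (y' t) (y t) ≤ c * ‖y t‖ ^ 2 + d * ‖y t‖) :
    ‖y b‖ ≤ Real.exp (c * (b - a)) * ‖y a‖ + d * Gains.h (b - a) c := by
  refine le_exp_of_left_slope_le hab hy.norm fun t ht => ?_
  by_cases h0 : y t = 0
  -- At a zero of `y` the norm cannot have increased from the left, so `0 ≤ d` suffices.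
  · refine ⟨fun _ => 0, 0, by simpa [h0] using hd, tendsto_const_nhds, ?_⟩
    filter_upwards with s
    simp [h0]
  · have hpos : 0 < ‖y t‖ := norm_pos_iff.2 h0
    -- Expand `‖y t‖ ^ 2` as the pairing of `y s + (t - s) • slope` with `y t`. Keeping the later
    -- point in the second slot uses continuity in the first argument only, and `s < t` allows
    -- positive homogeneity.
    refine ⟨fun s => wp (slope y t s) (y t) / ‖y t‖, wp (y' t) (y t) / ‖y t‖, ?_, ?_, ?_⟩
    · rw [div_le_iff₀ hpos]
      linarith [hle t ht]
    · refine Tendsto.div_const (((hwp.continuous_left (y t)).tendsto _).comp ?_) _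
      exact (hasDerivAt_iff_tendsto_slope.1 (hy' t ht)).mono_left
        (nhdsWithin_mono t fun s hs => ne_of_lt hs)
    · filter_upwards [self_mem_nhdsWithin] with s hs
      have hst : 0 < t - s := sub_pos.2 hs
      have h1 : y t - y s = (t - s) • slope y t s := by
        rw [slope_comm, slope_def_module, smul_smul, mul_inv_cancel₀ hst.ne', one_smul]
      have h2 := hwp.add_le (y s) (y t - y s) (y t)
      rw [add_sub_cancel, hn, h1, hwp.smul_left _ hst.le] at h2
      have h3 := hwp.le_norm_mul_norm hn (y s) (y t)
      rw [mul_div_assoc', le_div_iff₀ hpos]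
      nlinarith

end IsWeakPairing

/-! ### The weighted norm on the plane and its operator norm. -/

section WeightedNorm

variable {η : Fin 2 → ℝ}

theorem wNorm_nonneg (η v : Fin 2 → ℝ) : 0 ≤ wNorm η v := Real.sqrt_nonneg _

theorem wNorm_eq (η v : Fin 2 → ℝ) : wNorm η v = Real.sqrt (η 0 * v 0 ^ 2 + η 1 * v 1 ^ 2) := by
  simp [wNorm, Fin.sum_univ_two, sq_abs]

theorem wNorm_sq (hη : ∀ i, 0 < η i) (v : Fin 2 → ℝ) :
    wNorm η v ^ 2 = η 0 * v 0 ^ 2 + η 1 * v 1 ^ 2 := by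
  rw [wNorm_eq, Real.sq_sqrt]
  have := (hη 0).le; have := (hη 1).le
  positivity

theorem wNorm_le_of_sq_le (hη : ∀ i, 0 < η i) {u v : Fin 2 → ℝ} {K : ℝ} (hK : 0 ≤ K)
    (h : η 0 * u 0 ^ 2 + η 1 * u 1 ^ 2 ≤ K ^ 2 * (η 0 * v 0 ^ 2 + η 1 * v 1 ^ 2)) :
    wNorm η u ≤ K * wNorm η v := by
  rw [← wNorm_sq hη, ← wNorm_sq hη, ← mul_pow] at h
  exact le_of_sq_le_sq h (mul_nonneg hK (wNorm_nonneg _ _))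

theorem wNorm_mono (hη : ∀ i, 0 < η i) {u v : Fin 2 → ℝ} (hu : 0 ≤ u) (h : u ≤ v) :
    wNorm η u ≤ wNorm η v := by
  rw [wNorm_eq, wNorm_eq]
  have h0 := pow_le_pow_left₀ (hu 0) (h 0) 2
  have h1 := pow_le_pow_left₀ (hu 1) (h 1) 2
  exact Real.sqrt_le_sqrt (add_le_add (mul_le_mul_of_nonneg_left h0 (hη 0).le)
    (mul_le_mul_of_nonneg_left h1 (hη 1).le))

theorem wNorm_smul (η : Fin 2 → ℝ) (c : ℝ) (v : Fin 2 → ℝ) :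
    wNorm η (c • v) = |c| * wNorm η v := by
  rw [wNorm_eq, wNorm_eq, ← Real.sqrt_sq_eq_abs, ← Real.sqrt_mul (sq_nonneg c)]
  congr 1
  simp only [Pi.smul_apply, smul_eq_mul]
  ring

theorem wNorm_eq_zero (hη : ∀ i, 0 < η i) {v : Fin 2 → ℝ} (h : wNorm η v = 0) : v = 0 := by
  have h1 := wNorm_sq hη v
  rw [h] at h1
  have h2 := mul_nonneg (hη 0).le (sq_nonneg (v 0))
  have h3 := mul_nonneg (hη 1).le (sq_nonneg (v 1))
  have h4 : η 0 * v 0 ^ 2 = 0 := by linarith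
  have h5 : η 1 * v 1 ^ 2 = 0 := by linarith
  ext i
  fin_cases i
  · simpa [(hη 0).ne'] using h4
  · simpa [(hη 1).ne'] using h5

/-- Needed because a real `sSup` is informative only on bounded sets. The bound is a weighted
Cauchy–Schwarz inequality applied to each row. -/
theorem bddAbove_wOpNorm (hη : ∀ i, 0 < η i) (M : Matrix (Fin 2) (Fin 2) ℝ) :
    BddAbove {r | ∃ v : Fin 2 → ℝ, wNorm η v = 1 ∧ r = wNorm η (M.mulVec v)} := by
  have h0 := hη 0
  have h1 := hη 1
  refine ⟨Real.sqrt (η 0 * (M 0 0 ^ 2 / η 0 + M 0 1 ^ 2 / η 1)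
    + η 1 * (M 1 0 ^ 2 / η 0 + M 1 1 ^ 2 / η 1)), ?_⟩
  rintro r ⟨v, hv, rfl⟩
  have hv2 := wNorm_sq hη v
  rw [hv, one_pow] at hv2
  have key : ∀ p s : ℝ, (p * v 0 + s * v 1) ^ 2 ≤ p ^ 2 / η 0 + s ^ 2 / η 1 := by
    intro p s
    have h2 : (p ^ 2 / η 0 + s ^ 2 / η 1) * (η 0 * v 0 ^ 2 + η 1 * v 1 ^ 2)
        - (p * v 0 + s * v 1) ^ 2 = (p * η 1 * v 1 - s * η 0 * v 0) ^ 2 / (η 0 * η 1) := by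
      field_simp; ring
    rw [← hv2, mul_one] at h2
    have : 0 ≤ (p * η 1 * v 1 - s * η 0 * v 0) ^ 2 / (η 0 * η 1) := by positivity
    linarith
  rw [wNorm_eq]
  refine Real.sqrt_le_sqrt ?_
  simp only [Matrix.mulVec, dotProduct, Fin.sum_univ_two]
  exact add_le_add (mul_le_mul_of_nonneg_left (key _ _) h0.le)
    (mul_le_mul_of_nonneg_left (key _ _) h1.le)

theorem wNorm_mulVec_le (hη : ∀ i, 0 < η i) (M : Matrix (Fin 2) (Fin 2) ℝ) (v : Fin 2 → ℝ) :
    wNorm η (M.mulVec v) ≤ wOpNorm η M * wNorm η v := by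
  by_cases hv : wNorm η v = 0
  · have hz := wNorm_eq_zero hη hv
    have : wNorm η (M.mulVec v) = 0 := by rw [hz]; simp [wNorm_eq]
    rw [this, hv, mul_zero]
  · have hpos : 0 < wNorm η v := lt_of_le_of_ne (wNorm_nonneg _ _) (Ne.symm hv)
    have h1 : wNorm η (M.mulVec ((wNorm η v)⁻¹ • v)) ≤ wOpNorm η M :=
      le_csSup (bddAbove_wOpNorm hη M) ⟨(wNorm η v)⁻¹ • v, by
        rw [wNorm_smul, abs_of_pos (inv_pos.2 hpos), inv_mul_cancel₀ hv], rfl⟩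
    rw [Matrix.mulVec_smul, wNorm_smul, abs_of_pos (inv_pos.2 hpos), inv_mul_le_iff₀ hpos] at h1
    linarith

theorem wOpNorm_nonneg (η : Fin 2 → ℝ) (M : Matrix (Fin 2) (Fin 2) ℝ) : 0 ≤ wOpNorm η M := by
  refine Real.sSup_nonneg ?_
  rintro r ⟨v, -, rfl⟩
  exact wNorm_nonneg _ _

theorem wNorm_pow_mulVec_le (hη : ∀ i, 0 < η i) (M : Matrix (Fin 2) (Fin 2) ℝ) (k : ℕ)
    (v : Fin 2 → ℝ) : wNorm η ((M ^ k).mulVec v) ≤ wOpNorm η M ^ k * wNorm η v := by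
  induction k with
  | zero => simp
  | succ k ih =>
    rw [pow_succ', ← Matrix.mulVec_mulVec, pow_succ', mul_assoc]
    exact (wNorm_mulVec_le hη _ _).trans (mul_le_mul_of_nonneg_left ih (wOpNorm_nonneg _ _))

theorem le_wOpNorm (hη : ∀ i, 0 < η i) {M : Matrix (Fin 2) (Fin 2) ℝ} {v : Fin 2 → ℝ} {K : ℝ}
    (hv : v ≠ 0) (h : K * wNorm η v ≤ wNorm η (M.mulVec v)) : K ≤ wOpNorm η M := by
  have hpos : 0 < wNorm η v :=
    lt_of_le_of_ne (wNorm_nonneg _ _) fun h0 => hv (wNorm_eq_zero hη h0.symm)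
  exact le_of_mul_le_mul_right (h.trans (wNorm_mulVec_le hη M v)) hpos

theorem wOpNorm_le {M : Matrix (Fin 2) (Fin 2) ℝ} {K : ℝ} (hK : 0 ≤ K)
    (h : ∀ v, wNorm η (M.mulVec v) ≤ K * wNorm η v) : wOpNorm η M ≤ K := by
  refine Real.sSup_le ?_ hK
  rintro r ⟨v, hv, rfl⟩
  simpa [hv] using h v

end WeightedNorm

/-! ### Perron root and adapted weights for nonnegative 2 × 2 matrices. -/

theorem Matrix.mulVec_mono {ι : Type*} [Fintype ι] {M : Matrix ι ι ℝ} (hM : ∀ i j, 0 ≤ M i j)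
    {u v : ι → ℝ} (h : u ≤ v) : M.mulVec u ≤ M.mulVec v := fun i =>
  Finset.sum_le_sum fun j _ => mul_le_mul_of_nonneg_left (h j) (hM i j)

/-- The Perron root of a nonnegative `2 × 2` matrix, characterised by its quadratic equation. -/
theorem exists_perron_root {a b c d : ℝ} (hb : 0 ≤ b) (hc : 0 ≤ c) :
    ∃ r : ℝ, (r - a) * (r - d) = b * c ∧ a ≤ r ∧ d ≤ r := by
  have hbc := mul_nonneg hb hc
  have hD : 0 ≤ (a - d) ^ 2 + 4 * (b * c) := by positivity
  have hs := Real.sq_sqrt hD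
  have habs : |a - d| ≤ Real.sqrt ((a - d) ^ 2 + 4 * (b * c)) :=
    Real.abs_le_sqrt (by linarith)
  have h1 := (le_abs_self _).trans habs
  have h2 := (neg_le_abs _).trans habs
  refine ⟨(a + d + Real.sqrt ((a - d) ^ 2 + 4 * (b * c))) / 2, ?_, by linarith, by linarith⟩
  linear_combination hs / 4

/-- The characteristic polynomial splits with roots `r` and `a + d - r`. The second lies in `[-r,
r]` because `0 ≤ a ≤ r` and `0 ≤ d ≤ r`. -/
theorem specRad_eq {a b c d r : ℝ} (ha : 0 ≤ a) (hd : 0 ≤ d)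
    (hr : (r - a) * (r - d) = b * c) (har : a ≤ r) (hdr : d ≤ r) :
    specRad !![a, b; c, d] = r := by
  have hr0 : 0 ≤ r := ha.trans har
  have hspec : ∀ μ : ℂ, μ ∈ spectrum ℂ ((!![a, b; c, d]).map (algebraMap ℝ ℂ)) ↔
      (μ - r) * (μ - (a + d - r)) = 0 := by
    intro μ
    rw [spectrum.mem_iff, Matrix.isUnit_iff_isUnit_det, isUnit_iff_ne_zero, not_not]
    have hr' : ((r : ℂ) - a) * (r - d) = b * c := by exact_mod_cast congrArg Complex.ofReal hr
    have : (algebraMap ℂ (Matrix (Fin 2) (Fin 2) ℂ) μ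
        - (!![a, b; c, d]).map (algebraMap ℝ ℂ)).det = (μ - r) * (μ - (a + d - r)) := by
      rw [Matrix.det_fin_two]
      simp [Matrix.algebraMap_matrix_apply]
      linear_combination hr'
    rw [this]
  have hsr : spectralRadius ℂ ((!![a, b; c, d]).map (algebraMap ℝ ℂ)) = ENNReal.ofReal r := by
    refine le_antisymm ?_ ?_
    · refine iSup₂_le fun μ hμ => ?_
      have hle : ‖μ‖ ≤ r := by
        rcases mul_eq_zero.1 ((hspec μ).1 hμ) with h | h
        · rw [sub_eq_zero.1 h, Complex.norm_real, Real.norm_of_nonneg hr0]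
        · have : μ = ((a + d - r : ℝ) : ℂ) := by push_cast; exact sub_eq_zero.1 h
          rw [this, Complex.norm_real, Real.norm_eq_abs, abs_le]
          constructor <;> linarith
      change ‖μ‖ₑ ≤ _
      rw [← ofReal_norm]
      exact ENNReal.ofReal_le_ofReal hle
    · have hmem : (r : ℂ) ∈ spectrum ℂ ((!![a, b; c, d]).map (algebraMap ℝ ℂ)) :=
        (hspec r).2 (by simp)
      refine le_trans (le_of_eq ?_) (le_iSup₂ (f := fun k (_ : k ∈ spectrum ℂ _) =>
        (‖k‖₊ : ENNReal)) (r : ℂ) hmem)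
      change _ = ‖(r : ℂ)‖ₑ
      rw [← ofReal_norm, Complex.norm_real, Real.norm_of_nonneg hr0]
  rw [specRad, hsr, ENNReal.toReal_ofReal hr0]

/-- Diagonal scaling symmetrises a positive `2 × 2` matrix. -/
theorem wOpNorm_eq_of_pos {a b c d r : ℝ} (ha : 0 ≤ a) (hb : 0 < b) (hc : 0 < c) (hd : 0 ≤ d)
    (hr : (r - a) * (r - d) = b * c) (har : a ≤ r) :
    wOpNorm ![c, b] !![a, b; c, d] = r := by
  have hη : ∀ i, 0 < (![c, b] : Fin 2 → ℝ) i := by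
    intro i; fin_cases i <;> simp [hb, hc]
  have hr0 : 0 ≤ r := ha.trans har
  have har' : 0 < r - a := by
    refine lt_of_le_of_ne (by linarith) fun h => ?_
    rw [← h, zero_mul] at hr
    exact (mul_pos hb hc).ne hr
  refine le_antisymm (wOpNorm_le hr0 fun v => ?_) ?_
  · refine wNorm_le_of_sq_le hη hr0 ?_
    -- The form `r² ‖v‖² - ‖M v‖²` is a nonnegative multiple of a square: it vanishes on the Perron
    -- eigenvector `(b, r - a)`, which also gives the reverse bound below.
    have hid : (r - a) * (r ^ 2 * (c * v 0 ^ 2 + b * v 1 ^ 2)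
        - (c * (a * v 0 + b * v 1) ^ 2 + b * (c * v 0 + d * v 1) ^ 2))
        = (a + d) * (c * ((r - a) * v 0 - b * v 1) ^ 2) := by
      linear_combination ((r - a) * (c * v 0 ^ 2 + b * v 1 ^ 2) + (a + d) * b * v 1 ^ 2) * hr
    have hnn : 0 ≤ (a + d) * (c * ((r - a) * v 0 - b * v 1) ^ 2) := by positivity
    rw [← hid] at hnn
    have := nonneg_of_mul_nonneg_right hnn har'
    simp [Matrix.mulVec, dotProduct, Fin.sum_univ_two]
    linarith
  · refine le_wOpNorm hη (v := ![b, r - a]) (fun h => hb.ne' (congrFun h 0)) (le_of_eq ?_)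
    have : (!![a, b; c, d]).mulVec ![b, r - a] = r • ![b, r - a] := by
      ext i
      fin_cases i
      · simp; ring
      · simp; linear_combination -hr
    rw [this, wNorm_smul, abs_of_nonneg hr0]

/-- Weights for which a nonnegative matrix, acting on the range of a unipotent lower triangular
matrix, decays at the rate of its spectral radius. -/
theorem exists_weights {a b c d q r : ℝ} (ha : 0 < a) (hb : 0 < b) (hq : 0 < q)
    (hcd : (0 < c ∧ 0 ≤ d) ∨ (c = 0 ∧ d = 0))
    (hr : (r - a) * (r - d) = b * c) (har : a ≤ r) (hdr : d ≤ r) :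
    ∃ η : Fin 2 → ℝ, (∀ i, 0 < η i) ∧ (0 < c → wOpNorm η !![a, b; c, d] = r) ∧
      ∀ (k : ℕ) (v : Fin 2 → ℝ), wNorm η ((!![a, b; c, d] ^ k).mulVec ((!![1, 0; q, 1]).mulVec v))
        ≤ r ^ k * wOpNorm η !![1, 0; q, 1] * wNorm η v := by
  have hr0 : 0 ≤ r := ha.le.trans har
  rcases hcd with ⟨hc, hd⟩ | ⟨rfl, rfl⟩
  · have hη : ∀ i, 0 < (![c, b] : Fin 2 → ℝ) i := by
      intro i; fin_cases i <;> simp [hb, hc]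
    have hop := wOpNorm_eq_of_pos ha.le hb hc hd hr har
    refine ⟨![c, b], hη, fun _ => hop, fun k v => ?_⟩
    have h1 := wNorm_pow_mulVec_le hη (!![a, b; c, d]) k ((!![1, 0; q, 1]).mulVec v)
    rw [hop] at h1
    have h2 := wNorm_mulVec_le hη (!![1, 0; q, 1]) v
    rw [mul_assoc]
    exact h1.trans (mul_le_mul_of_nonneg_left h2 (pow_nonneg hr0 k))
  · have hra : r = a := by
      rw [mul_zero, sub_zero] at hr
      rcases mul_eq_zero.1 hr with h | h <;> linarith
    subst hra
    set S := (r + b * q) ^ 2 + b ^ 2 with hS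
    have hSpos : 0 < S := by positivity
    -- With first weight `e`, the vector `(1, 0)` gives `N ^ 2 ≥ q ^ 2 / e`, while the squared norm
    -- of the product of the two matrices is at most `S`. Hence `e * S ≤ r ^ 2 * q ^ 2` is what
    -- bounds that product by `r * N`; `e ≤ 1` serves in the bound by `S`.
    set e := min 1 (r ^ 2 * q ^ 2 / S) with he
    have he0 : 0 < e := lt_min one_pos (by positivity)
    have he1 : e ≤ 1 := min_le_left _ _
    have he2 : e * S ≤ r ^ 2 * q ^ 2 := by
      rw [← le_div_iff₀ hSpos]; exact min_le_right _ _
    have hη : ∀ i, 0 < (![e, 1] : Fin 2 → ℝ) i := by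
      intro i; fin_cases i <;> simp [he0]
    set N := wOpNorm ![e, 1] !![1, 0; q, 1] with hN
    have hN0 : 0 ≤ N := wOpNorm_nonneg _ _
    have hNq : q ^ 2 ≤ e * N ^ 2 := by
      have h1 := wNorm_mulVec_le hη !![1, 0; q, 1] ![1, 0]
      have h2 := pow_le_pow_left₀ (wNorm_nonneg _ _) h1 2
      rw [mul_pow, wNorm_sq hη, wNorm_sq hη] at h2
      simp at h2
      linarith
    have hstep : ∀ v : Fin 2 → ℝ, wNorm ![e, 1] ((!![r, b; 0, 0]).mulVec
        ((!![1, 0; q, 1]).mulVec v)) ≤ r * N * wNorm ![e, 1] v := by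
      intro v
      refine wNorm_le_of_sq_le hη (by positivity) ?_
      simp [Matrix.mulVec, dotProduct, Fin.sum_univ_two]
      have hcs : e * (r * v 0 + b * (q * v 0 + v 1)) ^ 2
          ≤ S * (e * v 0 ^ 2 + v 1 ^ 2) := by
        have h1 := sq_nonneg ((r + b * q) * v 1 - e * b * v 0)
        have h2 : e * (r * v 0 + b * (q * v 0 + v 1)) ^ 2 + ((r + b * q) * v 1 - e * b * v 0) ^ 2
          = ((r + b * q) ^ 2 + e * b ^ 2) * (e * v 0 ^ 2 + v 1 ^ 2) := by ring
        have h3 : e * b ^ 2 ≤ b ^ 2 := mul_le_of_le_one_left (sq_nonneg b) he1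
        have h4 : 0 ≤ e * v 0 ^ 2 + v 1 ^ 2 := by positivity
        have h5 := mul_le_mul_of_nonneg_right h3 h4
        rw [hS]
        linarith
      have hSN : S ≤ (r * N) ^ 2 := by
        refine le_of_mul_le_mul_left (he2.trans ?_) he0
        nlinarith [mul_le_mul_of_nonneg_left hNq (sq_nonneg r)]
      have h4 : 0 ≤ e * v 0 ^ 2 + v 1 ^ 2 := by positivity
      exact hcs.trans (mul_le_mul_of_nonneg_right hSN h4)
    refine ⟨![e, 1], hη, fun h => absurd h (lt_irrefl _), fun k v => ?_⟩
    cases k with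
    | zero =>
      rw [pow_zero, pow_zero, one_mul, Matrix.one_mulVec]
      exact wNorm_mulVec_le hη _ v
    | succ k =>
      -- The matrix has rank one, so only its first power needs an estimate.
      have hpow : !![r, b; 0, 0] ^ (k + 1) = r ^ k • !![r, b; 0, 0] := by
        induction k with
        | zero => simp
        | succ k ih =>
          have hsq : !![r, b; 0, 0] * !![r, b; 0, 0] = r • !![r, b; 0, 0] := by
            ext i j
            fin_cases i <;> fin_cases j <;> simp [Matrix.mul_apply, Fin.sum_univ_two]
          rw [pow_succ, ih, Matrix.smul_mul, hsq, smul_smul, ← pow_succ]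
      rw [hpow, Matrix.smul_mulVec, wNorm_smul, abs_of_nonneg (by positivity)]
      calc r ^ k * _ ≤ r ^ k * (r * N * wNorm ![e, 1] v) :=
            mul_le_mul_of_nonneg_left (hstep v) (by positivity)
        _ = _ := by ring

/-! ### Pointwise inequalities from the minimal Lipschitz constants. -/

section LipschitzConstants

variable {P V W : Type*} [NormedAddCommGroup V] [NormedAddCommGroup W]

theorem lipConst_nonneg (F : P → V → W) (A : Set P) (C : Set V) : 0 ≤ lipConst F A C := by
  refine Real.sSup_nonneg ?_
  rintro r ⟨p, -, v₁, -, v₂, -, -, rfl⟩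
  positivity

theorem UniformlyLipschitz.norm_sub_le {F : P → V → W} {A : Set P} {C : Set V}
    (h : UniformlyLipschitz F A C) {p : P} (hp : p ∈ A) {v₁ v₂ : V} (h₁ : v₁ ∈ C) (h₂ : v₂ ∈ C) :
    ‖F p v₁ - F p v₂‖ ≤ lipConst F A C * ‖v₁ - v₂‖ := by
  by_cases hne : v₁ = v₂
  · simp [hne]
  · rw [← div_le_iff₀ (norm_pos_iff.2 (sub_ne_zero.2 hne))]
    exact le_csSup h ⟨p, hp, v₁, h₁, v₂, h₂, hne, rfl⟩

theorem wp_le_of_osLip_le [NormedSpace ℝ V] {wp : V → V → ℝ} (hn : ∀ x, wp x x = ‖x‖ ^ 2)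
    {F : V → V} {C : Set V} {c : ℝ} (h : osLip wp F C ≤ (c : EReal)) {v₁ v₂ : V} (h₁ : v₁ ∈ C)
    (h₂ : v₂ ∈ C) : wp (F v₁ - F v₂) (v₁ - v₂) ≤ c * ‖v₁ - v₂‖ ^ 2 := by
  by_cases hne : v₁ = v₂
  · simp [hne, hn]
  · have hpos : 0 < ‖v₁ - v₂‖ ^ 2 := pow_pos (norm_pos_iff.2 (sub_ne_zero.2 hne)) 2
    rw [← div_le_iff₀ hpos]
    simp only [osLip, iSup_le_iff] at h
    exact EReal.coe_le_coe_iff.1 (h v₁ h₁ v₂ h₂ hne)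

end LipschitzConstants

/-! ### The sampling bound and static estimates. -/

namespace Gains

/-- The Lipschitz constant of the equilibrium map. -/
noncomputable def q (g : Gains) : ℝ := g.Gx / (1 - g.Gz)

theorem L_eq (g : Gains) : g.L = !![1, 0; g.q, 1] := rfl

theorem h_lt_of_lt_Tmax {g : Gains} {ζ ξ T : ℝ} {n : ℕ} (hK : 0 < g.C2 n + g.C1 / ζ)
    (hl : g.Gz ^ n ≤ 1)     (hT : (T : EReal) < g.Tmax ζ ξ n) : h T ξ * (g.C2 n + g.C1 / ζ) < 1 - g.Gz ^ n := by
  rw [← lt_div_iff₀ hK]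
  unfold Tmax at hT
  unfold h
  split_ifs at hT ⊢ with h0 h1
  · exact EReal.coe_lt_coe_iff.1 hT
  · have hT' := EReal.coe_lt_coe_iff.1 hT
    rw [mul_div_assoc] at hT' h1
    rcases lt_or_gt_of_ne h0 with hneg | hpos
    · rw [one_div, inv_mul_eq_div, lt_div_iff_of_neg hneg, mul_comm T, Real.log_lt_iff_lt_exp h1] at hT'
      rw [div_lt_iff_of_neg hneg]
      linarith
    · rw [one_div, inv_mul_eq_div, lt_div_iff₀ hpos, mul_comm T, Real.lt_log_iff_exp_lt h1] at hT'
      rw [div_lt_iff₀ hpos]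
      linarith
  -- Infinite bound: here `ξ < 0`, and `h T ξ < 1 / |ξ|` for every `T`, which is already at most `(1
  -- - ℓ^n) / (C₂ + C₁ / ζ)`.
  · rw [mul_div_assoc] at h1
    have hneg : ξ < 0 := by
      refine lt_of_le_of_ne (le_of_not_gt fun hpos => h1 ?_) h0
      have := div_nonneg (sub_nonneg.2 hl) hK.le
      positivity
    rw [div_lt_iff_of_neg hneg]
    linarith [Real.exp_pos (ξ * T)]

end Gains

/-- Pointwise form of the standing assumptions on the interconnection. -/
structure InterconnectionBounds {E F : Type*} [NormedAddCommGroup E] [NormedAddCommGroup F]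
    (wp : E → E → ℝ) (f : E → F → E) (G : E → F → F) (zstar : E → F) (X : Set E) (Z : Set F)
    (g : Gains) (ξ ζ : ℝ) : Prop where
  zero_mem_X : (0 : E) ∈ X
  zero_mem_Z : (0 : F) ∈ Z
  f_zero : f 0 0 = 0
  G_zero : G 0 0 = 0
  fx_nonneg : 0 ≤ g.fx
  fz_pos : 0 < g.fz
  Gx_pos : 0 < g.Gx
  Gz_nonneg : 0 ≤ g.Gz
  Gz_lt : g.Gz < 1
  mapsTo : ∀ x ∈ X, ∀ z ∈ Z, G x z ∈ Z
  fx_le : ∀ z ∈ Z, ∀ x ∈ X, ∀ x' ∈ X, ‖f x z - f x' z‖ ≤ g.fx * ‖x - x'‖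
  fz_le : ∀ x ∈ X, ∀ z ∈ Z, ∀ z' ∈ Z, ‖f x z - f x z'‖ ≤ g.fz * ‖z - z'‖
  Gx_le : ∀ z ∈ Z, ∀ x ∈ X, ∀ x' ∈ X, ‖G x z - G x' z‖ ≤ g.Gx * ‖x - x'‖
  Gz_le : ∀ x ∈ X, ∀ z ∈ Z, ∀ z' ∈ Z, ‖G x z - G x z'‖ ≤ g.Gz * ‖z - z'‖
  zstar_mem : ∀ x ∈ X, zstar x ∈ Z
  zstar_fixed : ∀ x ∈ X, G x (zstar x) = zstar x
  os_le : ∀ z ∈ Z, ∀ x ∈ X, ∀ x' ∈ X, wp (f x z - f x' z) (x - x') ≤ ξ * ‖x - x'‖ ^ 2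
  os_reduced_le : ∀ x ∈ X, ∀ x' ∈ X,
    wp (f x (zstar x) - f x' (zstar x')) (x - x') ≤ -ζ * ‖x - x'‖ ^ 2
  ζ_pos : 0 < ζ

namespace InterconnectionBounds

section Static

variable {E F : Type*} [NormedAddCommGroup E] [NormedAddCommGroup F]
  {wp : E → E → ℝ} {f : E → F → E} {G : E → F → F} {zstar : E → F} {X : Set E} {Z : Set F}
  {g : Gains} {ξ ζ : ℝ}

theorem q_pos (H : InterconnectionBounds wp f G zstar X Z g ξ ζ) : 0 < g.q :=
  div_pos H.Gx_pos (sub_pos.2 H.Gz_lt)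

/-- Insert `G x' (zstar x)` between the two fixed points and absorb the term with factor `ℓ < 1`. -/
theorem zstar_le (H : InterconnectionBounds wp f G zstar X Z g ξ ζ) {x x' : E} (hx : x ∈ X)
    (hx' : x' ∈ X) : ‖zstar x - zstar x'‖ ≤ g.q * ‖x - x'‖ := by
  have h1 : ‖zstar x - zstar x'‖ ≤ g.Gx * ‖x - x'‖ + g.Gz * ‖zstar x - zstar x'‖ := by
    calc ‖zstar x - zstar x'‖ = ‖(G x (zstar x) - G x' (zstar x))
          + (G x' (zstar x) - G x' (zstar x'))‖ := by
            rw [H.zstar_fixed x hx, H.zstar_fixed x' hx']; congr 1; abel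
      _ ≤ _ := (norm_add_le _ _).trans (add_le_add
          (H.Gx_le _ (H.zstar_mem x hx) _ hx _ hx')
          (H.Gz_le _ hx' _ (H.zstar_mem x hx) _ (H.zstar_mem x' hx')))
  rw [Gains.q, div_mul_eq_mul_div, le_div_iff₀ (sub_pos.2 H.Gz_lt)]
  linarith

theorem zstar_zero (H : InterconnectionBounds wp f G zstar X Z g ξ ζ) : zstar 0 = 0 := by
  have h1 := H.Gz_le 0 H.zero_mem_X _ (H.zstar_mem 0 H.zero_mem_X) 0 H.zero_mem_Z
  rw [H.zstar_fixed 0 H.zero_mem_X, H.G_zero, sub_zero] at h1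
  by_contra h0
  nlinarith [H.Gz_lt, norm_pos_iff.2 h0]

theorem norm_zstar_le (H : InterconnectionBounds wp f G zstar X Z g ξ ζ) {x : E} (hx : x ∈ X) :
    ‖zstar x‖ ≤ g.q * ‖x‖ := by
  simpa [H.zstar_zero] using H.zstar_le hx H.zero_mem_X

theorem iterate_mem_and_le (H : InterconnectionBounds wp f G zstar X Z g ξ ζ) {x : E} (hx : x ∈ X)
    {z : F} (hz : z ∈ Z) (n : ℕ) :
    (G x)^[n] z ∈ Z ∧ ‖(G x)^[n] z - zstar x‖ ≤ g.Gz ^ n * ‖z - zstar x‖ := by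
  induction n with
  | zero => simp [hz]
  | succ n ih =>
    rw [Function.iterate_succ_apply']
    refine ⟨H.mapsTo x hx _ ih.1, ?_⟩
    have h1 := H.Gz_le x hx _ ih.1 _ (H.zstar_mem x hx)
    rw [H.zstar_fixed x hx] at h1
    rw [pow_succ', mul_assoc]
    exact h1.trans (mul_le_mul_of_nonneg_left ih.2 H.Gz_nonneg)

/-- Passing through `f x (zstar x)` and `f 0 (zstar x)` produces the factor `Lip_x(f) + Lip_z(f) q`
of `C1` and `C21`. -/
theorem norm_f_le (H : InterconnectionBounds wp f G zstar X Z g ξ ζ) {x : E} (hx : x ∈ X)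
    {z : F} (hz : z ∈ Z) :
    ‖f x z‖ ≤ g.fz * ‖z - zstar x‖ + (g.fx + g.fz * g.q) * ‖x‖ := by
  have hs := H.zstar_mem x hx
  have h1 := H.fz_le x hx z hz _ hs
  have h2 := H.fx_le _ hs x hx 0 H.zero_mem_X
  have h3 := H.fz_le 0 H.zero_mem_X _ hs 0 H.zero_mem_Z
  rw [sub_zero] at h2
  rw [H.f_zero, sub_zero, sub_zero] at h3
  have h4 := mul_le_mul_of_nonneg_left (H.norm_zstar_le hx) H.fz_pos.le
  have h5 : ‖f x z‖ ≤ ‖f x z - f x (zstar x)‖ + ‖f x (zstar x) - f 0 (zstar x)‖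
      + ‖f 0 (zstar x)‖ := by
    refine le_trans (le_of_eq ?_) norm_add₃_le
    congr 1; abel
  linarith

theorem C1_pos (H : InterconnectionBounds wp f G zstar X Z g ξ ζ) : 0 < g.C1 := by
  have := H.fz_pos; have := H.Gx_pos; have := H.fx_nonneg; have := sub_pos.2 H.Gz_lt
  unfold Gains.C1; positivity

theorem C2_nonneg (H : InterconnectionBounds wp f G zstar X Z g ξ ζ) (n : ℕ) : 0 ≤ g.C2 n := by
  have := H.fz_pos; have := H.Gx_pos; have := H.Gz_nonneg; have := sub_pos.2 H.Gz_lt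
  unfold Gains.C2; positivity

theorem C12_pos (H : InterconnectionBounds wp f G zstar X Z g ξ ζ) : 0 < g.C12 := by
  have := H.fz_pos; have := H.Gx_pos; have := sub_pos.2 H.Gz_lt
  unfold Gains.C12; positivity

theorem C1_eq (g : Gains) : g.C1 = g.fz * g.q * (g.fx + g.fz * g.q) := by
  unfold Gains.C1 Gains.q; ring

theorem C2_eq (g : Gains) (n : ℕ) : g.C2 n = g.Gz ^ n * (g.q * g.fz) := by
  unfold Gains.C2 Gains.q; ring

theorem C12_eq (g : Gains) : g.C12 = g.fz * g.q * g.fz := by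
  unfold Gains.C12 Gains.q; ring

theorem C21_eq (g : Gains) (n : ℕ) : g.C21 n = g.Gz ^ n * (g.q * (g.fx + g.fz * g.q)) := by
  unfold Gains.C21 Gains.q; ring

end Static

end InterconnectionBounds

/-- Growth of the distance to a point within one sampling period. -/
theorem IsSolution.norm_sub_le {E F : Type*} [NormedAddCommGroup E] [NormedSpace ℝ E]
    {wp : E → E → ℝ} {f : E → F → E} {G : E → F → F} {n : ℕ} {T : ℝ} {x : ℝ → E} {z : ℝ → F}
    (hs : IsSolution f G n T x z)
    (hwp : IsWeakPairing wp) (hn : ∀ x, wp x x = ‖x‖ ^ 2) (hT : 0 < T) (k : ℕ) (w : E) {c d t : ℝ} (hd : 0 ≤ d)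
    (ht : t ∈ Icc (k * T) ((k + 1) * T))
    (hle : ∀ s ∈ Ioo (k * T) t,
      wp (f (x s) (z (k * T))) (x s - w) ≤ c * ‖x s - w‖ ^ 2 + d * ‖x s - w‖) :
    ‖x t - w‖ ≤ Real.exp (c * (t - k * T)) * ‖x (k * T) - w‖ + d * Gains.h (t - k * T) c := by
  -- The right endpoint is allowed although `z` may jump there: only interior derivatives and
  -- continuity of `x` enter.
  refine hwp.norm_le_of_deriv hn (y := fun s => x s - w) (y' := fun s => f (x s) (z (k * T)))
    ht.1 hd ?_ ?_ hle
  · refine (hs.continuousOn.mono fun s hs' => ?_).sub continuousOn_const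
    exact (mul_nonneg k.cast_nonneg hT.le).trans hs'.1
  · intro s hs'
    have hmem : s ∈ Ioo (k * T) ((k + 1) * T) := ⟨hs'.1, hs'.2.trans_le ht.2⟩
    have h1 := (hs.hasDeriv k s (Ioo_subset_Ico_self hmem)).hasDerivAt (Ico_mem_nhds hmem.1 hmem.2)
    rw [hs.hold k s (Ioo_subset_Ico_self hmem)] at h1
    exact h1.sub_const w

/-! ### Spectral radius of the gain matrix. -/

namespace Gains

theorem Abar_zero_zero (g : Gains) (ζ ξ : ℝ) (n : ℕ) (T : ℝ) : g.Abar ζ ξ n T 0 0 =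
    Real.exp (-ζ * T) + (1 - Real.exp (-ζ * T)) / ζ * h T ξ * g.C1 := rfl

theorem Abar_zero_one (g : Gains) (ζ ξ : ℝ) (n : ℕ) (T : ℝ) : g.Abar ζ ξ n T 0 1 =
    (1 - Real.exp (-ζ * T)) / ζ * (g.fz + h T ξ * g.C12) := rfl

theorem Abar_one_zero (g : Gains) (ζ ξ : ℝ) (n : ℕ) (T : ℝ) :
    g.Abar ζ ξ n T 1 0 = h T ξ * g.C21 n := rfl

theorem Abar_one_one (g : Gains) (ζ ξ : ℝ) (n : ℕ) (T : ℝ) :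
    g.Abar ζ ξ n T 1 1 = h T ξ * g.C2 n + g.Gz ^ n := rfl

end Gains

namespace InterconnectionBounds

section Spectral

variable {E F : Type*} [NormedAddCommGroup E] [NormedAddCommGroup F]
  {wp : E → E → ℝ} {f : E → F → E} {G : E → F → F} {zstar : E → F} {X : Set E} {Z : Set F}
  {g : Gains} {ξ ζ : ℝ} {n : ℕ} {T : ℝ}

theorem Abar_nonneg (H : InterconnectionBounds wp f G zstar X Z g ξ ζ) (n : ℕ) (hT : 0 < T) :
    0 < g.Abar ζ ξ n T 0 0 ∧ 0 < g.Abar ζ ξ n T 0 1 ∧ 0 ≤ g.Abar ζ ξ n T 1 0 ∧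
      0 ≤ g.Abar ζ ξ n T 1 1 := by
  have hh := Gains.h_pos ξ hT
  have hC1 := H.C1_pos
  have hC2 := H.C2_nonneg n
  have hC12 := H.C12_pos
  have hfz := H.fz_pos
  have hfx := H.fx_nonneg
  have hGz := H.Gz_nonneg
  have hq := H.q_pos
  have hζ := H.ζ_pos
  have hτ : 0 < (1 - Real.exp (-ζ * T)) / ζ := by
    refine div_pos (sub_pos.2 (Real.exp_lt_one_iff.2 ?_)) hζ
    nlinarith
  rw [Gains.Abar_zero_zero, Gains.Abar_zero_one, Gains.Abar_one_zero, Gains.Abar_one_one, C21_eq]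
  exact ⟨by positivity, by positivity, by positivity, by positivity⟩

theorem exists_specRad_Abar (H : InterconnectionBounds wp f G zstar X Z g ξ ζ) (hn : 0 < n)
    (hT : 0 < T) (hTn : (T : EReal) < g.Tmax ζ ξ n) :
    0 < specRad (g.Abar ζ ξ n T) ∧ specRad (g.Abar ζ ξ n T) < 1 ∧
    ∃ η : Fin 2 → ℝ, (∀ i, 0 < η i) ∧
      (0 < g.Gz → wOpNorm η (g.Abar ζ ξ n T) = specRad (g.Abar ζ ξ n T)) ∧
      ∀ (k : ℕ) (v : Fin 2 → ℝ), wNorm η ((g.Abar ζ ξ n T ^ k).mulVec (g.L.mulVec v)) ≤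
        specRad (g.Abar ζ ξ n T) ^ k * wOpNorm η g.L * wNorm η v := by
  obtain ⟨ha, hb, hc, hd⟩ := H.Abar_nonneg (T := T) (n := n) hT
  obtain ⟨r, hr, har, hdr⟩ := exists_perron_root (a := g.Abar ζ ξ n T 0 0)
    (d := g.Abar ζ ξ n T 1 1) hb.le hc
  have hA : g.Abar ζ ξ n T = !![g.Abar ζ ξ n T 0 0, g.Abar ζ ξ n T 0 1;
    g.Abar ζ ξ n T 1 0, g.Abar ζ ξ n T 1 1] := Matrix.eta_fin_two _
  have hrad : specRad (g.Abar ζ ξ n T) = r := by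
    rw [hA]; exact specRad_eq ha.le hd hr har hdr
  have hh := Gains.h_pos ξ hT
  have hC1 := H.C1_pos
  have hC2 := H.C2_nonneg n
  have hfz := H.fz_pos
  have hfx := H.fx_nonneg
  have hGz := H.Gz_nonneg
  have hq := H.q_pos
  have hζ := H.ζ_pos
  -- For `ℓ = 0` the whole second row vanishes, since `n ≥ 1` gives `ℓ^n = 0`.
  have hcd : (0 < g.Gz ∧ 0 < g.Abar ζ ξ n T 1 0) ∨
      (g.Gz = 0 ∧ g.Abar ζ ξ n T 1 0 = 0 ∧ g.Abar ζ ξ n T 1 1 = 0) := by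
    rcases hGz.eq_or_lt with h0 | h0
    · refine Or.inr ⟨h0.symm, ?_, ?_⟩ <;>
      simp [Gains.Abar_one_zero, Gains.Abar_one_one, C21_eq, C2_eq, ← h0, hn.ne']
    · refine Or.inl ⟨h0, ?_⟩
      rw [Gains.Abar_one_zero, C21_eq]
      positivity
  have hr1 : r < 1 := by
    have hl : g.Gz ^ n ≤ 1 := pow_le_one₀ hGz H.Gz_lt.le
    have hln : 0 ≤ g.Gz ^ n := pow_nonneg hGz n
    have hbound := Gains.h_lt_of_lt_Tmax (by positivity) hl hTn
    set h₀ := Gains.h T ξ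
    have hb1 : ζ * h₀ * g.C2 n + h₀ * g.C1 < ζ * (1 - g.Gz ^ n) := by
      have := mul_lt_mul_of_pos_left hbound hζ
      field_simp at this
      linarith
    have hτ : 0 < (1 - Real.exp (-ζ * T)) / ζ := by
      refine div_pos (sub_pos.2 (Real.exp_lt_one_iff.2 ?_)) hζ
      nlinarith
    set τ := (1 - Real.exp (-ζ * T)) / ζ with hτ_def
    have hexp : Real.exp (-ζ * T) = 1 - τ * ζ := by rw [hτ_def]; field_simp; ring
    have e00 : g.Abar ζ ξ n T 0 0 = 1 - τ * (ζ - h₀ * g.C1) := by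
      have h1 : g.Abar ζ ξ n T 0 0 = Real.exp (-ζ * T) + τ * h₀ * g.C1 := rfl
      rw [h1, hexp]; ring
    have e01 : g.Abar ζ ξ n T 0 1 = τ * (g.fz + h₀ * g.C12) := rfl
    have e10 : g.Abar ζ ξ n T 1 0 = h₀ * g.C21 n := rfl
    have e11 : g.Abar ζ ξ n T 1 1 = h₀ * g.C2 n + g.Gz ^ n := rfl
    -- The terms quadratic in `h₀` cancel because `C1 * C2 = C12 * C21`, leaving the condition `T <
    -- T(n)`.
    have hdet : (1 - g.Abar ζ ξ n T 0 0) * (1 - g.Abar ζ ξ n T 1 1)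
        - g.Abar ζ ξ n T 0 1 * g.Abar ζ ξ n T 1 0
        = τ * (ζ * (1 - g.Gz ^ n) - (ζ * h₀ * g.C2 n + h₀ * g.C1)) := by
      rw [e00, e01, e10, e11, C1_eq, C2_eq, C12_eq, C21_eq]; ring
    have hdet_pos := mul_pos hτ (sub_pos.2 hb1)
    rw [← hdet] at hdet_pos
    have hd1 : g.Abar ζ ξ n T 1 1 < 1 := by
      rw [e11]
      have : 0 < h₀ * g.C1 := by positivity
      nlinarith
    have ha1 : g.Abar ζ ξ n T 0 0 < 1 := by
      have := mul_nonneg hb.le hc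
      by_contra hcon
      nlinarith
    -- If `r ≥ 1`, then `(r - a) * (r - d) ≥ (1 - a) * (1 - d) > b * c`, against the equation of the
    -- Perron root.
    by_contra hcon
    nlinarith
  rw [hrad]
  refine ⟨ha.trans_le har, hr1, ?_⟩
  obtain ⟨η, hη, hop, hdecay⟩ := exists_weights ha hb hq
    (hcd.imp (fun h => ⟨h.2, hd⟩) fun h => h.2) hr har hdr
  rw [← hA] at hop hdecay
  refine ⟨η, hη, fun h0 => hop ?_, hdecay⟩
  rcases hcd with h | h
  · exact h.2
  · exact absurd h.1 h0.ne'

end Spectral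

/-! ### Estimates along a solution, over one period and then over many. -/

section Dynamic

variable {E F : Type*} [NormedAddCommGroup E] [NormedSpace ℝ E] [NormedAddCommGroup F]
  {wp : E → E → ℝ} {f : E → F → E} {G : E → F → F} {zstar : E → F} {X : Set E} {Z : Set F}
  {g : Gains} {ξ ζ : ℝ} {n : ℕ} {T : ℝ} {x : ℝ → E} {z : ℝ → F}

/-- Grönwall about the sample: the velocity is a difference with one-sided constant `ξ` plus the
constant forcing `f` at the sample. -/
theorem norm_sub_sample_le (H : InterconnectionBounds wp f G zstar X Z g ξ ζ)
    (hwp : IsWeakPairing wp) (hn : ∀ x, wp x x = ‖x‖ ^ 2) (hs : IsSolution f G n T x z)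
    (hinv : ∀ t, 0 ≤ t → x t ∈ X ∧ z t ∈ Z) (hT : 0 < T) (k : ℕ) {t : ℝ}
    (ht : t ∈ Icc (k * T) ((k + 1) * T)) :
    ‖x t - x (k * T)‖ ≤ Gains.h T ξ * ‖f (x (k * T)) (z (k * T))‖ := by
  have hk : 0 ≤ k * T := mul_nonneg k.cast_nonneg hT.le
  have h1 := hs.norm_sub_le hwp hn hT k (x (k * T)) (c := ξ)
    (norm_nonneg (f (x (k * T)) (z (k * T)))) ht fun s hs' => by
      have h2 := hwp.le_add_norm hn (f (x s) (z (k * T)))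
        (f (x s) (z (k * T)) - f (x (k * T)) (z (k * T))) (x s - x (k * T))
      rw [sub_sub_cancel] at h2
      linarith [H.os_le _ (hinv _ hk).2 _ (hinv s (hk.trans hs'.1.le)).1 _ (hinv _ hk).1]
  rw [sub_self, norm_zero, mul_zero, zero_add] at h1
  rw [mul_comm (Gains.h T ξ)]
  exact h1.trans (mul_le_mul_of_nonneg_left
    ((Gains.h_mono ξ).monotone (by linarith [ht.2])) (norm_nonneg _))

theorem norm_sub_zstar_le (H : InterconnectionBounds wp f G zstar X Z g ξ ζ)
    (hwp : IsWeakPairing wp) (hn : ∀ x, wp x x = ‖x‖ ^ 2) (hs : IsSolution f G n T x z)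
    (hinv : ∀ t, 0 ≤ t → x t ∈ X ∧ z t ∈ Z) (hT : 0 < T) (k : ℕ) {t : ℝ}
    (ht : t ∈ Icc (k * T) ((k + 1) * T)) :
    ‖z (k * T) - zstar (x t)‖ ≤ ‖z (k * T) - zstar (x (k * T))‖ + g.q * (Gains.h T ξ *
      (g.fz * ‖z (k * T) - zstar (x (k * T))‖ + (g.fx + g.fz * g.q) * ‖x (k * T)‖)) := by
  have hk : 0 ≤ k * T := mul_nonneg k.cast_nonneg hT.le
  have h1 := H.norm_sub_sample_le hwp hn hs hinv hT k ht
  have h2 := h1.trans (mul_le_mul_of_nonneg_left (H.norm_f_le (hinv _ hk).1 (hinv _ hk).2)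
    (Gains.h_nonneg ξ hT.le))
  have h3 := H.zstar_le (hinv _ hk).1 (hinv t (hk.trans ht.1)).1
  rw [norm_sub_rev (x _)] at h3
  have h4 := norm_sub_le_norm_sub_add_norm_sub (z (k * T)) (zstar (x (k * T))) (zstar (x t))
  linarith [mul_le_mul_of_nonneg_left h2 H.q_pos.le]

theorem norm_le_of_mem_Icc (H : InterconnectionBounds wp f G zstar X Z g ξ ζ)
    (hwp : IsWeakPairing wp) (hn : ∀ x, wp x x = ‖x‖ ^ 2) (hs : IsSolution f G n T x z)
    (hinv : ∀ t, 0 ≤ t → x t ∈ X ∧ z t ∈ Z) (hT : 0 < T) (k : ℕ) {t : ℝ}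
    (ht : t ∈ Icc (k * T) ((k + 1) * T)) :
    ‖x t‖ ≤ max (Real.exp (ξ * T)) 1 * ‖x (k * T)‖ + g.fz * Gains.h T ξ * ‖z (k * T)‖ := by
  have hk : 0 ≤ k * T := mul_nonneg k.cast_nonneg hT.le
  have h1 := hs.norm_sub_le hwp hn hT k 0 (c := ξ)
    (mul_nonneg H.fz_pos.le (norm_nonneg (z (k * T)))) ht fun s hs' => by
      have h2 := hwp.le_add_norm hn (f (x s) (z (k * T)))
        (f (x s) (z (k * T)) - f 0 (z (k * T))) (x s - 0)
      rw [sub_sub_cancel] at h2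
      have h3 := H.fz_le 0 H.zero_mem_X _ (hinv _ hk).2 0 H.zero_mem_Z
      rw [H.f_zero, sub_zero, sub_zero] at h3
      have h4 := mul_le_mul_of_nonneg_right h3 (norm_nonneg (x s - 0))
      linarith [H.os_le _ (hinv _ hk).2 _ (hinv s (hk.trans hs'.1.le)).1 0 H.zero_mem_X]
  rw [sub_zero, sub_zero] at h1
  have h5 : Real.exp (ξ * (t - k * T)) ≤ max (Real.exp (ξ * T)) 1 := by
    rcases le_total 0 ξ with h0 | h0
    · refine le_max_of_le_left (Real.exp_le_exp.2 (mul_le_mul_of_nonneg_left ?_ h0))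
      linarith [ht.2]
    · exact le_max_of_le_right (Real.exp_le_one_iff.2
        (mul_nonpos_of_nonpos_of_nonneg h0 (sub_nonneg.2 ht.1)))
  have h6 : Gains.h (t - k * T) ξ ≤ Gains.h T ξ :=
    (Gains.h_mono ξ).monotone (by linarith [ht.2])
  have h7 := mul_le_mul_of_nonneg_right h5 (norm_nonneg (x (k * T)))
  have h8 := mul_le_mul_of_nonneg_left h6 (mul_nonneg H.fz_pos.le (norm_nonneg (z (k * T))))
  linarith

/-- Grönwall for the reduced dynamics, with rate `-ζ`; replacing `zstar (x s)` by the held input is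
a forcing of size `Lip_z(f)` times the bound of `norm_sub_zstar_le`. -/
theorem norm_next_le (H : InterconnectionBounds wp f G zstar X Z g ξ ζ)
    (hwp : IsWeakPairing wp) (hn : ∀ x, wp x x = ‖x‖ ^ 2) (hs : IsSolution f G n T x z)
    (hinv : ∀ t, 0 ≤ t → x t ∈ X ∧ z t ∈ Z) (hT : 0 < T) (k : ℕ) :
    ‖x ((k + 1) * T)‖ ≤ Real.exp (-ζ * T) * ‖x (k * T)‖ +
      g.fz * (‖z (k * T) - zstar (x (k * T))‖ + g.q * (Gains.h T ξ *
        (g.fz * ‖z (k * T) - zstar (x (k * T))‖ + (g.fx + g.fz * g.q) * ‖x (k * T)‖))) *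
      ((1 - Real.exp (-ζ * T)) / ζ) := by
  have hk : 0 ≤ k * T := mul_nonneg k.cast_nonneg hT.le
  have hkT : (k : ℝ) * T ≤ (k + 1) * T := by linarith
  have hd := (norm_nonneg _).trans
    (H.norm_sub_zstar_le hwp hn hs hinv hT k (left_mem_Icc.2 hkT))
  have h1 := hs.norm_sub_le hwp hn hT k 0 (c := -ζ) (mul_nonneg H.fz_pos.le hd)
    (right_mem_Icc.2 hkT) fun s hs' => by
      have hxs := (hinv s (hk.trans hs'.1.le)).1
      have h2 := hwp.le_add_norm hn (f (x s) (z (k * T))) (f (x s) (zstar (x s))) (x s - 0)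
      have h3 := H.fz_le _ hxs _ (hinv _ hk).2 _ (H.zstar_mem _ hxs)
      have h4 := h3.trans (mul_le_mul_of_nonneg_left
        (H.norm_sub_zstar_le hwp hn hs hinv hT k (Ioo_subset_Icc_self hs')) H.fz_pos.le)
      have h5 := H.os_reduced_le _ hxs 0 H.zero_mem_X
      rw [H.zstar_zero, H.f_zero, sub_zero] at h5
      linarith [mul_le_mul_of_nonneg_right h4 (norm_nonneg (x s - 0))]
  have h6 : ((k : ℝ) + 1) * T - k * T = T := by ring
  have h7 : Gains.h T (-ζ) = (1 - Real.exp (-ζ * T)) / ζ := by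
    rw [Gains.h, if_neg (neg_ne_zero.2 H.ζ_pos.ne'), div_neg, ← neg_div, neg_sub]
  rw [sub_zero, sub_zero, h6, h7] at h1
  exact h1

theorem norm_next_sub_zstar_le (H : InterconnectionBounds wp f G zstar X Z g ξ ζ)
    (hwp : IsWeakPairing wp) (hn : ∀ x, wp x x = ‖x‖ ^ 2) (hs : IsSolution f G n T x z)
    (hinv : ∀ t, 0 ≤ t → x t ∈ X ∧ z t ∈ Z) (hT : 0 < T) (k : ℕ) :
    ‖z ((k + 1) * T) - zstar (x ((k + 1) * T))‖ ≤ g.Gz ^ n *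
      (‖z (k * T) - zstar (x (k * T))‖ + g.q * (Gains.h T ξ *
        (g.fz * ‖z (k * T) - zstar (x (k * T))‖ + (g.fx + g.fz * g.q) * ‖x (k * T)‖))) := by
  have hk : 0 ≤ k * T := mul_nonneg k.cast_nonneg hT.le
  have hkT : (k : ℝ) * T ≤ (k + 1) * T := by linarith
  rw [hs.update]
  exact (H.iterate_mem_and_le (hinv _ (hk.trans hkT)).1 (hinv _ hk).2 n).2.trans
    (mul_le_mul_of_nonneg_left
      (H.norm_sub_zstar_le hwp hn hs hinv hT k (right_mem_Icc.2 hkT)) (pow_nonneg H.Gz_nonneg n))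

theorem error_next_le (H : InterconnectionBounds wp f G zstar X Z g ξ ζ)
    (hwp : IsWeakPairing wp) (hn : ∀ x, wp x x = ‖x‖ ^ 2) (hs : IsSolution f G n T x z)
    (hinv : ∀ t, 0 ≤ t → x t ∈ X ∧ z t ∈ Z) (hT : 0 < T) (k : ℕ) :
    ![‖x ((k + 1) * T)‖, ‖z ((k + 1) * T) - zstar (x ((k + 1) * T))‖] ≤
      (g.Abar ζ ξ n T).mulVec ![‖x (k * T)‖, ‖z (k * T) - zstar (x (k * T))‖] := by
  have h1 := H.norm_next_le hwp hn hs hinv hT k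
  have h2 := H.norm_next_sub_zstar_le hwp hn hs hinv hT k
  intro i
  simp only [Gains.Abar, C1_eq, C2_eq, C12_eq, C21_eq]
  fin_cases i
  · refine h1.trans (le_of_eq ?_)
    simp [Matrix.mulVec, dotProduct, Fin.sum_univ_two]
    ring
  · refine h2.trans (le_of_eq ?_)
    simp [Matrix.mulVec, dotProduct, Fin.sum_univ_two]
    ring

theorem error_le_pow (H : InterconnectionBounds wp f G zstar X Z g ξ ζ)
    (hwp : IsWeakPairing wp) (hn : ∀ x, wp x x = ‖x‖ ^ 2) (hs : IsSolution f G n T x z)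
    (hinv : ∀ t, 0 ≤ t → x t ∈ X ∧ z t ∈ Z) (hT : 0 < T) (k : ℕ) :
    ![‖x (k * T)‖, ‖z (k * T) - zstar (x (k * T))‖] ≤
      (g.Abar ζ ξ n T ^ k).mulVec (g.L.mulVec ![‖x 0‖, ‖z 0‖]) := by
  induction k with
  | zero =>
    have h1 := norm_sub_le (z 0) (zstar (x 0))
    have h2 := H.norm_zstar_le (hinv 0 le_rfl).1
    intro i
    rw [Gains.L_eq]
    fin_cases i
    · simp [Matrix.mulVec, dotProduct, Fin.sum_univ_two]
    · simp [Matrix.mulVec, dotProduct, Fin.sum_univ_two]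
      linarith
  | succ k ih =>
    obtain ⟨ha, hb, hc, hd⟩ := H.Abar_nonneg (T := T) (n := n) hT
    rw [pow_succ', ← Matrix.mulVec_mulVec]
    push_cast
    refine (H.error_next_le hwp hn hs hinv hT k).trans (Matrix.mulVec_mono (fun i j => ?_) ih)
    fin_cases i <;> fin_cases j <;> first | exact ha.le | exact hb.le | exact hc | exact hd

theorem wNorm_sample_le (H : InterconnectionBounds wp f G zstar X Z g ξ ζ)
    (hwp : IsWeakPairing wp) (hn : ∀ x, wp x x = ‖x‖ ^ 2) (hs : IsSolution f G n T x z)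
    (hinv : ∀ t, 0 ≤ t → x t ∈ X ∧ z t ∈ Z) (hT : 0 < T) {η : Fin 2 → ℝ} (hη : ∀ i, 0 < η i)
    (k : ℕ) {t : ℝ} (ht : t ∈ Ico (k * T) ((k + 1) * T)) :
    wNorm η ![‖x t‖, ‖z t‖] ≤ wOpNorm η (g.B ξ T) * (wOpNorm η g.L *
      wNorm η ((g.Abar ζ ξ n T ^ k).mulVec (g.L.mulVec ![‖x 0‖, ‖z 0‖]))) := by
  have hk : 0 ≤ k * T := mul_nonneg k.cast_nonneg hT.le
  have hnn : ∀ p r : ℝ, 0 ≤ p → 0 ≤ r → (0 : Fin 2 → ℝ) ≤ ![p, r] := by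
    intro p r hp hr i
    fin_cases i
    · exact hp
    · exact hr
  have h1 : ![‖x t‖, ‖z t‖] ≤ (g.B ξ T).mulVec ![‖x (k * T)‖, ‖z (k * T)‖] := by
    have := H.norm_le_of_mem_Icc hwp hn hs hinv hT k (Ico_subset_Icc_self ht)
    rw [hs.hold k t ht]
    intro i
    fin_cases i
    · simpa [Gains.B, Matrix.mulVec, dotProduct, Fin.sum_univ_two] using this
    · simp [Gains.B, Matrix.mulVec, dotProduct, Fin.sum_univ_two]
  -- Second use of `L`, now to return from `z - zstar x` to `z`.
  have h2 : ![‖x (k * T)‖, ‖z (k * T)‖] ≤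
      g.L.mulVec ![‖x (k * T)‖, ‖z (k * T) - zstar (x (k * T))‖] := by
    have h3 := H.norm_zstar_le (hinv _ hk).1
    have h4 := norm_le_norm_sub_add (z (k * T)) (zstar (x (k * T)))
    intro i
    rw [Gains.L_eq]
    fin_cases i
    · simp [Matrix.mulVec, dotProduct, Fin.sum_univ_two]
    · simp [Matrix.mulVec, dotProduct, Fin.sum_univ_two]
      linarith
  have h3 := wNorm_mono hη (hnn _ _ (norm_nonneg _) (norm_nonneg _))
    (H.error_le_pow hwp hn hs hinv hT k)
  refine (wNorm_mono hη (hnn _ _ (norm_nonneg _) (norm_nonneg _)) h1).trans ?_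
  refine (wNorm_mulVec_le hη _ _).trans (mul_le_mul_of_nonneg_left ?_ (wOpNorm_nonneg _ _))
  refine (wNorm_mono hη (hnn _ _ (norm_nonneg _) (norm_nonneg _)) h2).trans ?_
  exact (wNorm_mulVec_le hη _ _).trans (mul_le_mul_of_nonneg_left h3 (wOpNorm_nonneg _ _))

end Dynamic

end InterconnectionBounds

/-! ### From sampling instants to continuous time. -/

theorem Gains.one_le_wOpNorm_B (g : Gains) (ξ T : ℝ) {η : Fin 2 → ℝ} (hη : ∀ i, 0 < η i) :
    1 ≤ wOpNorm η (g.B ξ T) := by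
  refine le_wOpNorm hη (v := ![0, 1]) (fun h => one_ne_zero (congrFun h 1)) ?_
  rw [one_mul, wNorm_eq, wNorm_eq]
  refine Real.sqrt_le_sqrt ?_
  simp [Gains.B, Matrix.mulVec, dotProduct, Fin.sum_univ_two]
  exact mul_nonneg (hη 0).le (sq_nonneg _)

/-- A geometric decay at the sampling instants is an exponential decay in continuous time. -/
theorem pow_le_inv_mul_exp {r T t : ℝ} (hr : 0 < r) (hr1 : r < 1) (hT : 0 < T) {k : ℕ}
    (ht : t ≤ (k + 1) * T) :
    r ^ k ≤ 1 / r * Real.exp (-(-(1 / T) * Real.log r) * t) := by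
  -- The factor `1 / r` raises the exponent to `k + 1`, which is at least `t / T`.
  rw [one_div_mul_eq_div, le_div_iff₀ hr, ← pow_succ, ← Real.exp_log (pow_pos hr (k + 1)),
    Real.exp_le_exp, Real.log_pow]
  have h1 : -(-(1 / T) * Real.log r) * t = t / T * Real.log r := by ring
  rw [h1]
  refine mul_le_mul_of_nonpos_right ?_ (Real.log_neg hr hr1).le
  rw [div_le_iff₀ hT]
  exact_mod_cast ht

theorem corollary1
    {E F : Type*} [NormedAddCommGroup E] [NormedSpace ℝ E] [FiniteDimensional ℝ E]
    [NormedAddCommGroup F] [NormedSpace ℝ F] [FiniteDimensional ℝ F]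
    (X : Set E) (Z : Set F) (hX : Convex ℝ X) (hZ : Convex ℝ Z)
    (hX0 : (0 : E) ∈ X) (hZ0 : (0 : F) ∈ Z)
    (f : E → F → E) (G : E → F → F)
    (hf : ContinuousOn (fun p : E × F => f p.1 p.2) (X ×ˢ Z))
    (hG : ContinuousOn (fun p : E × F => G p.1 p.2) (X ×ˢ Z))
    (hGZ : ∀ x ∈ X, ∀ z ∈ Z, G x z ∈ Z)
    (hf0 : f 0 0 = 0) (hG0 : G 0 0 = 0)
    -- a weak pairing compatible with the norm of `E`
    (wp : E → E → ℝ) (hwp : IsWeakPairing wp) (hwp_norm : ∀ x, wp x x = ‖x‖ ^ 2)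
    -- `f` is uniformly Lipschitz in `x`
    (hfx : UniformlyLipschitz (fun z x => f x z) Z X)
    -- Lipschitz interconnection
    (hfz : UniformlyLipschitz f X Z) (hfz_pos : 0 < (gains f G X Z).fz)
    (hGx : UniformlyLipschitz (fun z x => G x z) Z X) (hGx_pos : 0 < (gains f G X Z).Gx)
    -- `G` is uniformly contractive in `z`
    (hGz : UniformlyLipschitz G X Z) (hGz_lt : (gains f G X Z).Gz < 1)
    -- `zstar x` is the fixed point of `G x` in `Z`
    (zstar : E → F) (hzstar : ∀ x ∈ X, zstar x ∈ Z ∧ G x (zstar x) = zstar x)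
    (ξ ζ : ℝ) (hξ : osLipUnif wp (fun z x => f x z) Z X ≤ (ξ : EReal))
    (hζ : 0 < ζ) (hRM : osLip wp (fun x => f x (zstar x)) X ≤ ((-ζ : ℝ) : EReal))
    (n : ℕ) (hn : 0 < n) (T : ℝ) (hT : 0 < T) (hTn : (T : EReal) < (gains f G X Z).Tmax ζ ξ n) :
    0 < (gains f G X Z).rate ζ ξ n T ∧
    ∃ η : Fin 2 → ℝ, (∀ i, 0 < η i) ∧
      (0 < (gains f G X Z).Gz →
        wOpNorm η ((gains f G X Z).Abar ζ ξ n T) = specRad ((gains f G X Z).Abar ζ ξ n T)) ∧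
      ∀ (X₀ : Set E) (Z₀ : Set F), X₀ ⊆ X → Z₀ ⊆ Z →
        (∀ (x : ℝ → E) (z : ℝ → F), IsSolution f G n T x z → x 0 ∈ X₀ → z 0 ∈ Z₀ →
          ∀ t : ℝ, 0 ≤ t → x t ∈ X ∧ z t ∈ Z) →
        ∀ (x : ℝ → E) (z : ℝ → F), IsSolution f G n T x z → x 0 ∈ X₀ → z 0 ∈ Z₀ →
          ∀ t : ℝ, 0 ≤ t →
            wNorm η ![‖x t‖, ‖z t‖] ≤
              (gains f G X Z).overshoot ζ ξ n T η *
                Real.exp (-(gains f G X Z).rate ζ ξ n T * t) * wNorm η ![‖x 0‖, ‖z 0‖] := by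
  have H : InterconnectionBounds wp f G zstar X Z (gains f G X Z) ξ ζ :=
    { zero_mem_X := hX0
      zero_mem_Z := hZ0
      f_zero := hf0
      G_zero := hG0
      fx_nonneg := lipConst_nonneg _ _ _
      fz_pos := hfz_pos
      Gx_pos := hGx_pos
      Gz_nonneg := lipConst_nonneg _ _ _
      Gz_lt := hGz_lt
      mapsTo := hGZ
      fx_le := fun z hz x hx x' hx' => hfx.norm_sub_le hz hx hx'
      fz_le := fun x hx z hz z' hz' => hfz.norm_sub_le hx hz hz'
      Gx_le := fun z hz x hx x' hx' => hGx.norm_sub_le hz hx hx'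
      Gz_le := fun x hx z hz z' hz' => hGz.norm_sub_le hx hz hz'
      zstar_mem := fun x hx => (hzstar x hx).1
      zstar_fixed := fun x hx => (hzstar x hx).2
      os_le := fun z hz x hx x' hx' => wp_le_of_osLip_le hwp_norm
        ((le_iSup₂ (f := fun p (_ : p ∈ Z) => osLip wp (fun x => f x p) X) z hz).trans hξ) hx hx'
      os_reduced_le := fun x hx x' hx' => wp_le_of_osLip_le hwp_norm hRM hx hx'
      ζ_pos := hζ }
  obtain ⟨hρ0, hρ1, η, hη, hop, hdecay⟩ := H.exists_specRad_Abar hn hT hTn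
  refine ⟨?_, η, hη, hop, ?_⟩
  · rw [Gains.rate, neg_mul]
    exact neg_pos.2 (mul_neg_of_pos_of_neg (one_div_pos.2 hT) (Real.log_neg hρ0 hρ1))
  · intro X₀ Z₀ _ _ hinv x z hs hx0 hz0 t ht
    have hkt : t ∈ Ico (⌊t / T⌋₊ * T) ((⌊t / T⌋₊ + 1) * T) := by
      constructor
      · rw [← le_div_iff₀ hT]; exact Nat.floor_le (div_nonneg ht hT.le)
      · rw [← div_lt_iff₀ hT]; exact Nat.lt_floor_add_one _
    set k := ⌊t / T⌋₊
    have h1 := H.wNorm_sample_le hwp hwp_norm hs (hinv x z hs hx0 hz0) hT hη k hkt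
    have h2 := hdecay k ![‖x 0‖, ‖z 0‖]
    have h3 := pow_le_inv_mul_exp hρ0 hρ1 hT hkt.2.le
    have hB := (gains f G X Z).one_le_wOpNorm_B ξ T hη
    rw [Gains.overshoot, Gains.rate]
    set ρ := specRad ((gains f G X Z).Abar ζ ξ n T)
    set b := wOpNorm η ((gains f G X Z).B ξ T)
    set l := wOpNorm η (gains f G X Z).L
    set v := wNorm η ![‖x 0‖, ‖z 0‖]
    have hl : 0 ≤ l := wOpNorm_nonneg _ _
    have hv : 0 ≤ v := wNorm_nonneg _ _
    have hb : 0 ≤ b := zero_le_one.trans hB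
    calc wNorm η ![‖x t‖, ‖z t‖] ≤ b * (l * (ρ ^ k * l * v)) :=
          h1.trans (mul_le_mul_of_nonneg_left (mul_le_mul_of_nonneg_left h2 hl) hb)
      _ = b * (l ^ 2 * v * ρ ^ k) := by ring
      -- The argument yields one factor `‖B‖`; the square in `ϱ` is reached through `1 ≤ ‖B‖`.
      _ ≤ b ^ 2 * (l ^ 2 * v * (1 / ρ * Real.exp (-(-(1 / T) * Real.log ρ) * t))) := by
          refine mul_le_mul (le_self_pow₀ hB two_ne_zero)
            (mul_le_mul_of_nonneg_left h3 (by positivity)) (by positivity) (by positivity)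
      _ = _ := by ring
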